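/- Let $\mathbb{M}$ be either the Euclidean space $\mathbb{R}^3$ or the unit sphere $\mathbb{S}^3\subset\mathbb{R}^4$ with its round metric. Let $p\in\mathbb{M}$, let $v,w\in T_p\mathbb{M}$ be orthonormal, let $\gamma_v(t)=\exp_p(tv)$, and let $\Pi^+_{v,w}$ be the open totally geodesic half-plane bounded by $\gamma_v(\mathbb{R})$ on the side of $w$; that is, $\Pi^+_{v,w}=\{\exp_p(t_1v+t_2w): t_1\in\mathbb{R},\ t_2>0\}$, where in the case of $\mathbb{S}^3$ one also requires $|t_1v+t_2w|<\pi$. Let $\beta:[0,\infty)\to\Pi^+_{v,w}$ be a smooth regular curve of infinite length, and let $(R_\vartheta)_{\vartheta\in\mathbb{S}^1}$ be the group of rotations of $\mathbb{M}$ (orientation-preserving isometries) that fix the geodesic $\gamma_v$ pointwise, parametrized by the angle. Let $$\alpha:[0,\infty)\times\mathbb{S}^1\to\mathbb{M},\qquad \alpha(t,\vartheta)=R_\vartheta(\beta(t)),$$ be the complete end of revolution generated by $\beta$, and give $E=[0,\infty)\times\mathbb{S}^1$ the metric induced by $\alpha$. Then $E$ is parabolic: if $u_1,u_2$ are bounded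 continuous functions on $E$ that are of class $C^2$ and harmonic in the interior $(0,\infty)\times\mathbb{S}^1$ and coincide on the boundary $\{0\}\times\mathbb{S}^1$, then $u_1=u_2$ on $E$. -/

import Mathlib

open Set MeasureTheory
open scoped ContDiff

noncomputable section

namespace EndOfRevolution

/-- Euclidean 3-space. -/
abbrev E3 : Type := EuclideanSpace ℝ (Fin 3)

/-- Euclidean 4-space; the 3-sphere is its unit sphere, with the induced metric. -/
abbrev E4 : Type := EuclideanSpace ℝ (Fin 4)

/-! ### Surfaces parametrized by the half-cylinder, and their induced Laplacian -/

/-- The half-cylinder `[0, ∞) × 𝕊¹`, the surface with boundary `{0} × 𝕊¹` on which every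
end of revolution is parametrized. -/
def halfCylinder : Set (ℝ × Real.Angle) := Ici 0 ×ˢ univ

/-- A map on the cylinder read in the coordinates `(t, θ)`, where `θ` is a real number. -/
def lift {X : Type*} (f : ℝ × Real.Angle → X) (t θ : ℝ) : X := f (t, (θ : Real.Angle))

/-- Partial derivative in the first coordinate. -/
def partialT {X : Type*} [NormedAddCommGroup X] [NormedSpace ℝ X] (f : ℝ → ℝ → X) (t θ : ℝ) : X :=
  deriv (fun s => f s θ) t

/-- Partial derivative in the second coordinate. -/
def partialTheta {X : Type*} [NormedAddCommGroup X] [NormedSpace ℝ X] (f : ℝ → ℝ → X)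
    (t θ : ℝ) : X :=
  deriv (fun s => f t s) θ

section Metric

variable {V : Type*} [NormedAddCommGroup V] [InnerProductSpace ℝ V]

/-- The coefficient `g_tt` of the metric induced on the parameter domain by `F`. -/
def metricTT (F : ℝ → ℝ → V) (t θ : ℝ) : ℝ := inner ℝ (partialT F t θ) (partialT F t θ)

/-- The coefficient `g_tθ` of the induced metric. -/
def metricTTheta (F : ℝ → ℝ → V) (t θ : ℝ) : ℝ := inner ℝ (partialT F t θ) (partialTheta F t θ)

/-- The coefficient `g_θθ` of the induced metric. -/
def metricThetaTheta (F : ℝ → ℝ → V) (t θ : ℝ) : ℝ :=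
  inner ℝ (partialTheta F t θ) (partialTheta F t θ)

/-- The area density `√(det g)` of the induced metric. -/
def areaDensity (F : ℝ → ℝ → V) (t θ : ℝ) : ℝ :=
  Real.sqrt (metricTT F t θ * metricThetaTheta F t θ - metricTTheta F t θ ^ 2)

/-- The Laplace-Beltrami operator of the metric `g` induced by the immersion `F`, in coordinates:
`Δ u = (det g)^(-1/2) ∑ᵢⱼ ∂ᵢ ((det g)^(1/2) gⁱʲ ∂ⱼ u)`, with the inverse matrix of `g` written out. -/
def laplaceBeltrami (F : ℝ → ℝ → V) (u : ℝ → ℝ → ℝ) (t θ : ℝ) : ℝ :=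
  (areaDensity F t θ)⁻¹ *
    (partialT (fun a b => (metricThetaTheta F a b * partialT u a b
          - metricTTheta F a b * partialTheta u a b) / areaDensity F a b) t θ
      + partialTheta (fun a b => (metricTT F a b * partialTheta u a b
          - metricTTheta F a b * partialT u a b) / areaDensity F a b) t θ)

/-- `u` is a bounded harmonic function on the half-cylinder with the metric induced by `α`:
continuous up to the boundary, bounded, and of class `C²` with vanishing Laplacian at
interior points. -/
structure IsBoundedHarmonic (α : ℝ × Real.Angle → V) (u : ℝ × Real.Angle → ℝ) : Prop where
  continuousOn : ContinuousOn u halfCylinder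
  bounded : ∃ C : ℝ, ∀ x ∈ halfCylinder, |u x| ≤ C
  contDiffOn : ContDiffOn ℝ 2 (fun y : ℝ × ℝ => lift u y.1 y.2) (Ioi 0 ×ˢ univ)
  laplace_eq_zero : ∀ t : ℝ, 0 < t → ∀ θ : ℝ, laplaceBeltrami (lift α) (lift u) t θ = 0

/-- Parabolicity: a bounded harmonic function is determined by its boundary values. -/
def IsParabolic (α : ℝ × Real.Angle → V) : Prop :=
  ∀ u₁ u₂ : ℝ × Real.Angle → ℝ, IsBoundedHarmonic α u₁ → IsBoundedHarmonic α u₂ →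
    (∀ ϑ : Real.Angle, u₁ (0, ϑ) = u₂ (0, ϑ)) → EqOn u₁ u₂ halfCylinder

/-! ### Ends of revolution -/

/-- A curve `β : [0, ∞) → P` (values off `[0, ∞)` are irrelevant) that is smooth, regular and of
infinite length: the generating curves of complete ends. -/
structure IsCompleteGeneratingCurve (P : Set V) (β : ℝ → V) : Prop where
  mem : ∀ t : ℝ, 0 ≤ t → β t ∈ P
  smooth : ContDiffOn ℝ ∞ β (Ici 0)
  regular : ∀ t : ℝ, 0 ≤ t → derivWithin β (Ici 0) t ≠ 0
  infinite_length : ∫⁻ t in Ici (0 : ℝ), ‖derivWithin β (Ici 0) t‖ₑ = ⊤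

/-- For orthonormal `w`, `n`: the linear rotation by the angle `ϑ` in the plane spanned by `w`
and `n`, from `w` towards `n`; it fixes the orthogonal complement of that plane pointwise. -/
def planeRotation (w n : V) (ϑ : Real.Angle) (x : V) : V :=
  (x - inner ℝ w x • w - inner ℝ n x • n)
    + inner ℝ w x • (ϑ.cos • w + ϑ.sin • n)
    + inner ℝ n x • (-ϑ.sin • w + ϑ.cos • n)

end Metric

/-- The open half-plane of `ℝ³` which is bounded by the line `p + ℝ v`, on the side of `w`. -/
def euclideanHalfPlane (p v w : E3) : Set E3 :=
  {x | ∃ t₁ t₂ : ℝ, 0 < t₂ ∧ x = p + (t₁ • v + t₂ • w)}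

/-- The exponential map of the unit 3-sphere at `p`, on tangent vectors `u ⟂ p`:
`exp_p u = cos ‖u‖ p + sin ‖u‖ u / ‖u‖`. -/
def sphereExp (p u : E4) : E4 := Real.cos ‖u‖ • p + Real.sinc ‖u‖ • u

/-- For orthonormal `p`, `v`, `w`: the totally geodesic half-plane of the unit 3-sphere (an open
half of a great 2-sphere) which is bounded by the geodesic through `p` with direction `v`, on the
side of `w`. Beyond radius `π` the geodesics from `p` would enter the opposite half. -/
def sphericalHalfPlane (p v w : E4) : Set E4 :=
  {x | ∃ t₁ t₂ : ℝ, 0 < t₂ ∧ ‖t₁ • v + t₂ • w‖ < Real.pi ∧ x = sphereExp p (t₁ • v + t₂ • w)}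

/-- For `v`, `w`, `n` orthonormal: the end of revolution in `ℝ³` along the geodesic `p + ℝ v` with
generating curve `β`, as a map on the half-cylinder. -/
def euclideanEnd (p w n : E3) (β : ℝ → E3) (x : ℝ × Real.Angle) : E3 :=
  p + planeRotation w n x.2 (β x.1 - p)

/-- For `p`, `v`, `w`, `n` orthonormal: the end of revolution in the unit 3-sphere along the
geodesic through `p` with direction `v`, with generating curve `β`, as a map on the half-cylinder.
The rotations are the linear ones that fix `p` and `v`. -/
def sphericalEnd (w n : E4) (β : ℝ → E4) (x : ℝ × Real.Angle) : E4 :=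
  planeRotation w n x.2 (β x.1)

end EndOfRevolution

end

/-!
Let `r` be the distance-like coordinate `⟪w, β - p⟫` of the generating curve to the axis, taken with
`p = 0` for the sphere in `ℝ⁴`. The induced metric is `‖β'‖² dt² + r² dθ²`. In the conformal time
`τ = ∫ ‖β'‖ / r dt` it becomes `r² (dτ² + dθ²)`, so harmonic functions are those of a flat
half-cylinder (`fluxLaplacian_eq_zero_of_laplaceBeltrami`).

The half-cylinder is infinitely long: since `r' ≤ ‖β'‖`, the radius satisfies `r ≤ r(0) + s` for the
arc length `s`, hence `τ ≥ log ((r(0) + s) / r(0))`, and `s` is unbounded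
(`exists_le_integral_div`). This covers both ambient spaces at once; in the sphere `r` is even
bounded.

On an infinite half-cylinder `log (1 + τ)` is strictly superharmonic, nonnegative on the boundary
and tends to infinity. A bounded harmonic function that is nonpositive on the boundary is therefore
at most `ε log (1 + τ)` for every `ε > 0`, by the second derivative test at an interior maximum of
the difference (`nonpos_of_fluxLaplacian_eq_zero`). Applied to `u₁ - u₂` and `u₂ - u₁`, this gives
uniqueness.
-/

namespace EndOfRevolution

open Filter Topology

/-! ### A maximum principle on the half-cylinder -/

/-- Second derivative test for the operator `(q f')'`, with no differentiability of `q` or `f'`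
alone. -/
theorem nonpos_of_isLocalMax_of_hasDerivAt_mul_deriv {f q : ℝ → ℝ} {x G : ℝ}
    (hmax : IsLocalMax f x) (hf : ContinuousAt f x) (hq : ∀ᶠ a in 𝓝 x, 0 < q a)
    (hG : HasDerivAt (fun a => q a * deriv f a) G x) : G ≤ 0 := by
  by_contra! hpos
  have h0 : q x * deriv f x = 0 := by rw [hmax.deriv_eq_zero, mul_zero]
  have hsign := eventually_nhdsWithin_sign_eq_of_deriv_pos
    (f := fun a => q a * deriv f a) (by rwa [hG.deriv]) h0
  obtain ⟨δ, hδ, hball⟩ := Metric.eventually_nhds_iff.1 ((hsign.and hq).and hmax)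
  have hderiv : ∀ a, x < a → a < x + δ → 0 < deriv f a := by
    intro a h1 h2
    obtain ⟨⟨hs, hqa⟩, -⟩ := hball (y := a) (by rw [Real.dist_eq, abs_lt]; constructor <;> linarith)
    rw [sign_pos (sub_pos.2 h1), sign_eq_one_iff] at hs
    exact (pos_iff_pos_of_mul_pos hs).1 hqa
  have hmono : StrictMonoOn f (Icc x (x + δ / 2)) := by
    refine strictMonoOn_of_deriv_pos (convex_Icc _ _) ?_ ?_
    · intro a ha
      rcases ha.1.eq_or_lt with rfl | hlt
      · exact hf.continuousWithinAt
      · exact (differentiableAt_of_deriv_ne_zero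
          (hderiv a hlt (by linarith [ha.2])).ne').continuousAt.continuousWithinAt
    · intro a ha
      rw [interior_Icc] at ha
      exact hderiv a ha.1 (by linarith [ha.2])
  have h1 := hmono (left_mem_Icc.2 (by linarith)) (right_mem_Icc.2 (by linarith))
    (by linarith : x < x + δ / 2)
  have h2 := (hball (y := x + δ / 2) (by rw [Real.dist_eq, abs_lt]; constructor <;> linarith)).2
  linarith

/-- The operator `u ↦ ∂ₜ (q ∂ₜ u) + q⁻¹ ∂_θ² u`. For a metric `E dt² + G dθ²` that does not depend
on `θ`, it is the area density times the Laplacian, with `q = √(G / E)`. -/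
noncomputable def fluxLaplacian (q : ℝ → ℝ) (f : ℝ → ℝ → ℝ) (t θ : ℝ) : ℝ :=
  deriv (fun a => q a * partialT f a θ) t + (q t)⁻¹ * deriv (fun b => partialTheta f t b) θ

section Slices

variable {f : ℝ → ℝ → ℝ} (hf : ContDiffOn ℝ 2 (fun y : ℝ × ℝ => f y.1 y.2) (Ioi 0 ×ˢ univ))
include hf

theorem contDiffOn_slice_fst (θ : ℝ) : ContDiffOn ℝ 2 (fun a => f a θ) (Ioi 0) :=
  hf.comp (f := fun a => (a, θ)) (by fun_prop) fun _ ha => ⟨ha, mem_univ _⟩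

theorem contDiff_slice_snd {t : ℝ} (ht : 0 < t) : ContDiff ℝ 2 (fun b => f t b) :=
  contDiffOn_univ.1 <|
    hf.comp (f := fun b => (t, b)) (by fun_prop) fun _ _ => ⟨ht, mem_univ _⟩

theorem differentiableAt_slice_fst {t : ℝ} (ht : 0 < t) (θ : ℝ) :
    DifferentiableAt ℝ (fun a => f a θ) t :=
  ((contDiffOn_slice_fst hf θ).differentiableOn (by norm_num)).differentiableAt (Ioi_mem_nhds ht)

theorem differentiableAt_partialT {t : ℝ} (ht : 0 < t) (θ : ℝ) :
    DifferentiableAt ℝ (fun a => partialT f a θ) t :=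
  (((contDiffOn_slice_fst hf θ).deriv_of_isOpen (m := 1) isOpen_Ioi
    (by norm_num)).differentiableOn (by norm_num)).differentiableAt (Ioi_mem_nhds ht)

theorem differentiable_slice_snd {t : ℝ} (ht : 0 < t) : Differentiable ℝ (fun b => f t b) :=
  (contDiff_slice_snd hf ht).differentiable (by norm_num)

theorem differentiable_partialTheta {t : ℝ} (ht : 0 < t) :
    Differentiable ℝ (fun b => partialTheta f t b) := by
  have h := (contDiff_slice_snd hf ht).contDiffOn (s := univ)
  exact differentiableOn_univ.1
    ((h.deriv_of_isOpen (m := 1) isOpen_univ (by norm_num)).differentiableOn (by norm_num))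

end Slices

theorem fluxLaplacian_sub {q : ℝ → ℝ} {f g : ℝ → ℝ → ℝ}
    (hf : ContDiffOn ℝ 2 (fun y : ℝ × ℝ => f y.1 y.2) (Ioi 0 ×ˢ univ))
    (hg : ContDiffOn ℝ 2 (fun y : ℝ × ℝ => g y.1 y.2) (Ioi 0 ×ˢ univ))
    {t : ℝ} (ht : 0 < t) (hq : DifferentiableAt ℝ q t) (θ : ℝ) :
    fluxLaplacian q (fun a b => f a b - g a b) t θ
      = fluxLaplacian q f t θ - fluxLaplacian q g t θ := by
  have hT : (fun a => q a * partialT (fun a b => f a b - g a b) a θ) =ᶠ[𝓝 t]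
      fun a => q a * partialT f a θ - q a * partialT g a θ := by
    filter_upwards [Ioi_mem_nhds ht] with a ha
    rw [← mul_sub]
    exact congrArg _ (deriv_fun_sub (differentiableAt_slice_fst hf ha θ)
      (differentiableAt_slice_fst hg ha θ))
  have hΘ : (fun b => partialTheta (fun a b => f a b - g a b) t b) =
      fun b => partialTheta f t b - partialTheta g t b := by
    funext b
    exact deriv_fun_sub (differentiable_slice_snd hf ht b) (differentiable_slice_snd hg ht b)
  unfold fluxLaplacian
  rw [hT.deriv_eq, hΘ,
    deriv_fun_sub (hq.fun_mul (differentiableAt_partialT hf ht θ))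
      (hq.fun_mul (differentiableAt_partialT hg ht θ)),
    deriv_fun_sub (differentiable_partialTheta hf ht θ) (differentiable_partialTheta hg ht θ)]
  ring

theorem isCompact_univ_angle : IsCompact (univ : Set Real.Angle) := by
  have : Fact (0 < 2 * Real.pi) := ⟨Real.two_pi_pos⟩
  exact (inferInstance : CompactSpace (AddCircle (2 * Real.pi))).isCompact_univ

/-- Phragmén–Lindelöf principle on the half-cylinder. The time `τ = ∫ dt / q` is harmonic; since it
is unbounded, the strictly superharmonic functions `ε log (1 + τ)` are barriers at infinity. -/
theorem nonpos_of_fluxLaplacian_eq_zero {q τ : ℝ → ℝ} {u : ℝ × Real.Angle → ℝ}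
    (hq : ∀ t, 0 < t → 0 < q t) (hqd : ∀ t, 0 < t → DifferentiableAt ℝ q t)
    (hτc : ContinuousOn τ (Ici 0)) (hτ0 : ∀ t, 0 ≤ t → 0 ≤ τ t)
    (hτ : ∀ t, 0 < t → HasDerivAt τ (q t)⁻¹ t) (hτtop : ∀ M, ∃ t, 0 ≤ t ∧ M ≤ τ t)
    (huc : ContinuousOn u halfCylinder) {C : ℝ} (hC : ∀ x ∈ halfCylinder, u x ≤ C)
    (hu : ContDiffOn ℝ 2 (fun y : ℝ × ℝ => lift u y.1 y.2) (Ioi 0 ×ˢ univ))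
    (hΔ : ∀ t, 0 < t → ∀ θ, fluxLaplacian q (lift u) t θ = 0)
    (hbd : ∀ ϑ, u (0, ϑ) ≤ 0) : ∀ x ∈ halfCylinder, u x ≤ 0 := by
  have key : ∀ ε > 0, ∀ x ∈ halfCylinder, u x ≤ ε * Real.log (1 + τ x.1) := by
    intro ε hε x hx
    have hx1 : 0 ≤ x.1 := hx.1
    -- Beyond `T'` the barrier exceeds the bound for `u`; the maximum is taken over `[0, T]`, which
    -- also has to contain `x`.
    obtain ⟨T', hT', hτT'⟩ := hτtop (Real.exp (|C| / ε))
    have hmono : MonotoneOn τ (Ici 0) := by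
      refine monotoneOn_of_deriv_nonneg (convex_Ici 0) hτc ?_ ?_ <;> rw [interior_Ici]
      · exact fun t ht => (hτ t ht).differentiableAt.differentiableWithinAt
      · exact fun t ht => by rw [(hτ t ht).deriv]; exact (inv_pos.2 (hq t ht)).le
    set T := max T' x.1 with hT
    have hT0 : 0 ≤ T := le_max_of_le_left hT'
    have hτT : Real.exp (|C| / ε) ≤ τ T :=
      hτT'.trans (hmono hT' hT0 (le_max_left _ _))
    set w : ℝ × Real.Angle → ℝ := fun y => u y - ε * Real.log (1 + τ y.1) with hw
    have hsub : Icc 0 T ×ˢ (univ : Set Real.Angle) ⊆ halfCylinder :=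
      prod_mono Icc_subset_Ici_self subset_rfl
    have hwc : ContinuousOn w (Icc 0 T ×ˢ univ) := by
      refine (huc.mono hsub).sub (continuousOn_const.mul (ContinuousOn.log ?_ ?_))
      · exact continuousOn_const.add
          (hτc.comp continuousOn_fst fun y hy => (hsub hy).1)
      · intro y hy
        have := hτ0 y.1 (hsub hy).1
        positivity
    obtain ⟨⟨t, ϑ⟩, hy, hymax⟩ := (isCompact_Icc.prod isCompact_univ_angle).exists_isMaxOn
      ⟨x, ⟨hx1, le_max_right _ _⟩, mem_univ _⟩ hwc
    have hwx : w x ≤ w (t, ϑ) := hymax ⟨⟨hx1, le_max_right _ _⟩, mem_univ _⟩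
    suffices w (t, ϑ) ≤ 0 by
      have := hwx.trans this
      simp only [hw] at this
      linarith
    obtain ⟨⟨ht0, htT⟩, -⟩ := hy
    simp only at ht0 htT
    rcases ht0.eq_or_lt with rfl | ht
    · have := Real.log_nonneg (by linarith [hτ0 0 le_rfl] : 1 ≤ 1 + τ 0)
      have := mul_nonneg hε.le this
      simp only [hw]
      linarith [hbd ϑ]
    rcases htT.eq_or_lt with hteq | htT
    · have h1 : |C| / ε ≤ Real.log (1 + τ t) := by
        rw [Real.le_log_iff_exp_le (by linarith [hτ0 t ht0]), hteq]
        linarith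
      rw [div_le_iff₀ hε] at h1
      have h2 := hC (t, ϑ) ⟨ht0, mem_univ _⟩
      simp only [hw]
      linarith [le_abs_self C]
    -- An interior maximum contradicts the strict superharmonicity of the barrier.
    exfalso
    induction ϑ using Real.Angle.induction_on with | _ θ
    have hτpos : ∀ a, 0 < a → 0 < 1 + τ a := fun a ha => by linarith [hτ0 a ha.le]
    have hlog : ∀ a, 0 < a →
        HasDerivAt (fun a => ε * Real.log (1 + τ a)) (ε * ((q a)⁻¹ / (1 + τ a))) a :=
      fun a ha => (((hτ a ha).const_add 1).log (hτpos a ha).ne').const_mul ε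
    have hdw : ∀ a, 0 < a → HasDerivAt (fun a => w (a, θ))
        (partialT (lift u) a θ - ε * ((q a)⁻¹ / (1 + τ a))) a :=
      fun a ha => (differentiableAt_slice_fst hu ha θ).hasDerivAt.sub (hlog a ha)
    have hflux : HasDerivAt (fun a => q a * deriv (fun a => w (a, θ)) a)
        (deriv (fun a => q a * partialT (lift u) a θ) t
          - ε * (-(q t)⁻¹ / (1 + τ t) ^ 2)) t := by
      have h1 := ((hqd t ht).mul (differentiableAt_partialT hu ht θ)).hasDerivAt
      have h2 := (((hτ t ht).const_add 1).fun_inv (hτpos t ht).ne').const_mul ε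
      refine (h1.sub h2).congr_of_eventuallyEq ?_
      filter_upwards [Ioi_mem_nhds ht] with a ha
      rw [(hdw a ha).deriv]
      have := (hq a ha).ne'
      have := (hτpos a ha).ne'
      simp only [Pi.sub_apply, Pi.mul_apply]
      field_simp
    have hmaxT : IsLocalMax (fun a => w (a, θ)) t := by
      filter_upwards [Icc_mem_nhds ht htT] with a ha
      exact hymax ⟨ha, mem_univ _⟩
    have h1 := nonpos_of_isLocalMax_of_hasDerivAt_mul_deriv hmaxT (hdw t ht).continuousAt
      (by filter_upwards [Ioi_mem_nhds ht] with a ha using hq a ha) hflux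
    have hmaxΘ : IsLocalMax (fun b : ℝ => lift u t b) θ := by
      refine Eventually.of_forall fun b => ?_
      have : w (t, b) ≤ w (t, θ) := hymax ⟨⟨ht0, htT.le⟩, mem_univ _⟩
      simpa [hw, lift] using this
    have h2 := nonpos_of_isLocalMax_of_hasDerivAt_mul_deriv (q := fun _ => 1) hmaxΘ
      (differentiable_slice_snd hu ht θ).continuousAt (by simp)
      (G := deriv (fun b => partialTheta (lift u) t b) θ)
      (by
        simp only [one_mul]
        exact (differentiable_partialTheta hu ht θ).hasDerivAt)
    have h3 := hΔ t ht θ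
    unfold fluxLaplacian at h3
    have h4 := mul_nonpos_of_nonneg_of_nonpos (inv_pos.2 (hq t ht)).le h2
    have h5 : 0 < ε * ((q t)⁻¹ / (1 + τ t) ^ 2) :=
      mul_pos hε (div_pos (inv_pos.2 (hq t ht)) (pow_pos (hτpos t ht) 2))
    rw [neg_div, mul_neg] at h1
    linarith
  intro x hx
  have hlim : Tendsto (fun ε : ℝ => ε * Real.log (1 + τ x.1)) (𝓝[>] 0) (𝓝 0) := by
    have : Tendsto (fun ε : ℝ => ε * Real.log (1 + τ x.1)) (𝓝 0) (𝓝 (0 * _)) :=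
      tendsto_id.mul_const _
    rw [zero_mul] at this
    exact this.mono_left nhdsWithin_le_nhds
  exact ge_of_tendsto hlim (by filter_upwards [self_mem_nhdsWithin] with ε hε using key ε hε x hx)

/-! ### Divergence of the conformal time -/

/-- A positive function grows at most like its initial value plus `∫ σ` if `σ` bounds its
derivative, so `∫ σ / r` dominates `log (r 0 + ∫ σ)` and diverges with `∫ σ`. -/
theorem exists_le_integral_div {r σ : ℝ → ℝ} (hσ : Continuous σ) (hσ0 : ∀ t, 0 ≤ σ t)
    (hrc : Continuous r) (hr0 : ∀ t, 0 < r t)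
    (hr : ∀ t, 0 < t → ∃ r', HasDerivAt r r' t ∧ r' ≤ σ t)
    (hint : ¬ IntegrableOn σ (Ioi 0)) (M : ℝ) :
    ∃ t, 0 ≤ t ∧ M ≤ ∫ a in (0 : ℝ)..t, σ a / r a := by
  set s : ℝ → ℝ := fun t => ∫ a in (0 : ℝ)..t, σ a with hs
  have hsd : ∀ t, HasDerivAt s (σ t) t := fun t => (hσ.integral_hasStrictDerivAt 0 t).hasDerivAt
  have hdiv : Continuous fun a => σ a / r a := hσ.div hrc fun a => (hr0 a).ne'
  have hτd : ∀ t, HasDerivAt (fun t => ∫ a in (0 : ℝ)..t, σ a / r a) (σ t / r t) t :=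
    fun t => (hdiv.integral_hasStrictDerivAt 0 t).hasDerivAt
  have hs0 : ∀ t, 0 ≤ t → 0 ≤ s t := fun t ht =>
    intervalIntegral.integral_nonneg ht fun a _ => hσ0 a
  have hpos : ∀ t, 0 ≤ t → 0 < r 0 + s t := fun t ht => by linarith [hr0 0, hs0 t ht]
  have hrs : ∀ t, 0 ≤ t → r t ≤ r 0 + s t := by
    have hanti : AntitoneOn (fun t => r t - s t) (Ici 0) := by
      refine antitoneOn_of_deriv_nonpos (convex_Ici 0) ?_ ?_ ?_
      · exact hrc.continuousOn.sub fun t _ => (hsd t).continuousAt.continuousWithinAt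
      all_goals
        rw [interior_Ici]
        intro t ht
        obtain ⟨r', h1, h2⟩ := hr t ht
        have h3 := h1.sub (hsd t)
      · exact h3.differentiableAt.differentiableWithinAt
      · rw [show deriv (fun t => r t - s t) t = r' - σ t from h3.deriv]
        linarith
    intro t ht
    have := hanti self_mem_Ici ht ht
    simp only [hs, intervalIntegral.integral_same] at this ⊢
    linarith
  have hlog : MonotoneOn (fun t => (∫ a in (0 : ℝ)..t, σ a / r a) - Real.log (r 0 + s t))
      (Ici 0) := by
    have hd : ∀ t, 0 ≤ t → HasDerivAt
        (fun t => (∫ a in (0 : ℝ)..t, σ a / r a) - Real.log (r 0 + s t))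
        (σ t / r t - σ t / (r 0 + s t)) t :=
      fun t ht => (hτd t).sub (((hsd t).const_add _).log (hpos t ht).ne')
    refine monotoneOn_of_deriv_nonneg (convex_Ici 0)
      (fun t ht => (hd t ht).continuousAt.continuousWithinAt) ?_ ?_
    all_goals
      rw [interior_Ici]
      intro t ht
      have ht' : 0 ≤ t := le_of_lt ht
    · exact (hd t ht').differentiableAt.differentiableWithinAt
    · rw [(hd t ht').deriv, sub_nonneg]
      exact div_le_div_of_nonneg_left (hσ0 t) (hr0 t) (hrs t ht')
  obtain ⟨t, ht, hst⟩ : ∃ t, 0 ≤ t ∧ Real.exp (M + Real.log (r 0)) < s t := by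
    by_contra! hbdd
    refine hint (integrableOn_Ioi_of_intervalIntegral_norm_bounded (l := atTop) (b := id)
      (Real.exp (M + Real.log (r 0))) 0
      (fun t => hσ.integrableOn_Ioc) tendsto_id
      ((eventually_ge_atTop 0).mono fun t ht => ?_))
    simpa only [id, Real.norm_of_nonneg (hσ0 _)] using hbdd t ht
  refine ⟨t, ht, ?_⟩
  have h1 := hlog self_mem_Ici ht ht
  have h2 : M + Real.log (r 0) ≤ Real.log (r 0 + s t) := by
    rw [Real.le_log_iff_exp_le (hpos t ht)]
    linarith [hr0 0]
  simp only [hs, intervalIntegral.integral_same, add_zero] at h1 h2 ⊢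
  linarith

/-! ### The metric of an end of revolution -/

section Metric

variable {V : Type*} [NormedAddCommGroup V] [InnerProductSpace ℝ V] {w n : V}

theorem inner_planeRotation_self (hw : inner ℝ w w = 1) (hn : inner ℝ n n = 1)
    (hwn : inner ℝ w n = 0) (ϑ : Real.Angle) (x : V) :
    inner ℝ (planeRotation w n ϑ x) (planeRotation w n ϑ x) = inner ℝ x x := by
  have hnw : inner ℝ n w = 0 := by rw [real_inner_comm, hwn]
  have hcs := ϑ.cos_sq_add_sin_sq
  simp only [planeRotation, inner_add_left, inner_add_right, inner_sub_left, inner_sub_right,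
    real_inner_smul_left, real_inner_smul_right, hw, hn, hwn, hnw, real_inner_comm w x,
    real_inner_comm n x]
  linear_combination (inner ℝ w x ^ 2 + inner ℝ n x ^ 2) * hcs

theorem inner_planeRotation_normal (hw : inner ℝ w w = 1) (hn : inner ℝ n n = 1)
    (hwn : inner ℝ w n = 0) (ϑ : Real.Angle) (x : V) :
    inner ℝ (planeRotation w n ϑ x) (-ϑ.sin • w + ϑ.cos • n) = inner ℝ n x := by
  have hnw : inner ℝ n w = 0 := by rw [real_inner_comm, hwn]
  have hcs := ϑ.cos_sq_add_sin_sq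
  simp only [planeRotation, inner_add_left, inner_add_right, inner_sub_left,
    real_inner_smul_left, real_inner_smul_right, hw, hn, hwn, hnw, real_inner_comm w x,
    real_inner_comm n x]
  linear_combination (inner ℝ n x) * hcs

theorem inner_normal_self (hw : inner ℝ w w = 1) (hn : inner ℝ n n = 1)
    (hwn : inner ℝ w n = 0) (ϑ : Real.Angle) :
    inner ℝ (-ϑ.sin • w + ϑ.cos • n) (-ϑ.sin • w + ϑ.cos • n) = 1 := by
  have hnw : inner ℝ n w = 0 := by rw [real_inner_comm, hwn]
  have hcs := ϑ.cos_sq_add_sin_sq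
  simp only [inner_add_left, inner_add_right, real_inner_smul_left, real_inner_smul_right, hw, hn,
    hwn, hnw]
  linear_combination hcs

theorem hasDerivAt_planeRotation (ϑ : Real.Angle) {γ : ℝ → V} {γ' : V} {t : ℝ}
    (hγ : HasDerivAt γ γ' t) :
    HasDerivAt (fun s => planeRotation w n ϑ (γ s)) (planeRotation w n ϑ γ') t := by
  have hi : ∀ z : V, HasDerivAt (fun s => inner ℝ z (γ s)) (inner ℝ z γ') t := fun z => by
    simpa using (hasDerivAt_const t z).inner ℝ hγ
  exact (((hγ.sub ((hi w).smul_const w)).sub ((hi n).smul_const n)).add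
    ((hi w).smul_const _)).add ((hi n).smul_const _)

theorem hasDerivAt_planeRotation_angle {x : V} (hx : inner ℝ n x = 0) (θ : ℝ) :
    HasDerivAt (fun s : ℝ => planeRotation w n s x)
      (inner ℝ w x • (-(θ : Real.Angle).sin • w + (θ : Real.Angle).cos • n)) θ := by
  simp only [planeRotation, hx, zero_smul, add_zero, sub_zero, Real.Angle.cos_coe,
    Real.Angle.sin_coe]
  exact ((((Real.hasDerivAt_cos θ).smul_const w).add
    ((Real.hasDerivAt_sin θ).smul_const n)).const_smul _).const_add _

/-- The surface swept by the curve `β` under the rotations about `p` in the plane of `w` and `n`,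
in an ambient inner product space. The Euclidean ends are literally of this form, and the spherical
ones are the case `p = 0`. -/
noncomputable def revolution (p w n : V) (β : ℝ → V) (x : ℝ × Real.Angle) : V :=
  p + planeRotation w n x.2 (β x.1 - p)

/-- The induced metric is `‖β'‖² dt² + r² dθ²` with `r = ⟪w, β - p⟫`, so harmonicity is the equation
`fluxLaplacian (r / ‖β'‖) f = 0`. -/
theorem fluxLaplacian_eq_zero_of_laplaceBeltrami {p : V} (hw : inner ℝ w w = 1)
    (hn : inner ℝ n n = 1) (hwn : inner ℝ w n = 0) {β β' : ℝ → V}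
    (hβ : ∀ t, 0 < t → HasDerivAt β (β' t) t) (hβ' : ∀ t, 0 < t → β' t ≠ 0)
    (hplane : ∀ t, 0 < t → inner ℝ n (β t - p) = 0) (hpos : ∀ t, 0 < t → 0 < inner ℝ w (β t - p))
    {f : ℝ → ℝ → ℝ} {t θ : ℝ} (ht : 0 < t)
    (h : laplaceBeltrami (lift (revolution p w n β)) f t θ = 0) :
    fluxLaplacian (fun a => inner ℝ w (β a - p) / ‖β' a‖) f t θ = 0 := by
  set F := lift (revolution p w n β) with hF
  have hT : ∀ a b, 0 < a → partialT F a b = planeRotation w n b (β' a) := fun a b ha =>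
    ((hasDerivAt_planeRotation (w := w) (n := n) (b : Real.Angle)
      ((hβ a ha).sub_const p)).const_add p).deriv
  have hΘ : ∀ a (b : ℝ), 0 < a → partialTheta F a b = inner ℝ w (β a - p) •
      (-(b : Real.Angle).sin • w + (b : Real.Angle).cos • n) := fun a b ha =>
    ((hasDerivAt_planeRotation_angle (w := w) (hplane a ha) b).const_add p).deriv
  have hnβ' : ∀ a, 0 < a → inner ℝ n (β' a) = 0 := fun a ha => by
    have h1 : HasDerivAt (fun s => inner ℝ n (β s - p)) (inner ℝ n (β' a)) a := by
      simpa using (hasDerivAt_const a n).inner ℝ ((hβ a ha).sub_const p)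
    have h2 : (fun s => inner ℝ n (β s - p)) =ᶠ[𝓝 a] fun _ => 0 := by
      filter_upwards [Ioi_mem_nhds ha] with s hs using hplane s hs
    exact h1.unique ((hasDerivAt_const a (0 : ℝ)).congr_of_eventuallyEq h2)
  have hTT : ∀ a b, 0 < a → metricTT F a b = ‖β' a‖ ^ 2 := fun a b ha => by
    rw [metricTT, hT a b ha, inner_planeRotation_self hw hn hwn, real_inner_self_eq_norm_sq]
  have hTΘ : ∀ a b, 0 < a → metricTTheta F a b = 0 := fun a b ha => by
    rw [metricTTheta, hT a b ha, hΘ a b ha, real_inner_smul_right,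
      inner_planeRotation_normal hw hn hwn, hnβ' a ha, mul_zero]
  have hΘΘ : ∀ a b, 0 < a → metricThetaTheta F a b = inner ℝ w (β a - p) ^ 2 := fun a b ha => by
    rw [metricThetaTheta, hΘ a b ha, real_inner_smul_left, real_inner_smul_right,
      inner_normal_self hw hn hwn, mul_one, sq]
  have hA : ∀ a b, 0 < a → areaDensity F a b = ‖β' a‖ * inner ℝ w (β a - p) := fun a b ha => by
    rw [areaDensity, hTT a b ha, hTΘ a b ha, hΘΘ a b ha, zero_pow two_ne_zero, sub_zero, ← mul_pow,
      Real.sqrt_sq (mul_nonneg (norm_nonneg _) (hpos a ha).le)]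
  have hne : ∀ a, 0 < a → ‖β' a‖ ≠ 0 := fun a ha => norm_ne_zero_iff.2 (hβ' a ha)
  rw [laplaceBeltrami, hA t θ ht, mul_eq_zero_iff_left
    (inv_ne_zero (mul_ne_zero (hne t ht) (hpos t ht).ne'))] at h
  rw [fluxLaplacian, ← h]
  congr 1
  · refine EventuallyEq.deriv_eq ?_
    filter_upwards [Ioi_mem_nhds ht] with a ha
    rw [hΘΘ a θ ha, hTΘ a θ ha, hA a θ ha]
    have h1 := hne a ha
    have h2 := (hpos a ha).ne'
    field_simp
    ring
  · have h3 : (fun b => (metricTT F t b * partialTheta f t b - metricTTheta F t b * partialT f t b)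
        / areaDensity F t b) =
        fun b => (inner ℝ w (β t - p) / ‖β' t‖)⁻¹ * partialTheta f t b := by
      funext b
      rw [hTT t b ht, hTΘ t b ht, hA t b ht]
      have h1 := hne t ht
      have h2 := (hpos t ht).ne'
      field_simp
      ring
    rw [partialTheta, h3, deriv_const_mul_field]

/-- The end is conformal to the flat half-cylinder of length `∫ ‖β'‖ / r`, which is infinite because
`r` has derivative at most `‖β'‖`. -/
theorem isParabolic_revolution {p : V} (hw : inner ℝ w w = 1)
    (hn : inner ℝ n n = 1) (hwn : inner ℝ w n = 0) {P : Set V}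
    (hP : ∀ x ∈ P, inner ℝ n (x - p) = 0 ∧ 0 < inner ℝ w (x - p)) {β : ℝ → V}
    (hβ : IsCompleteGeneratingCurve P β) : IsParabolic (revolution p w n β) := by
  set β' : ℝ → V := derivWithin β (Ici 0) with hβ'
  have hβc : ContinuousOn β (Ici 0) := hβ.smooth.continuousOn
  have hβ'c : ContinuousOn β' (Ici 0) :=
    hβ.smooth.continuousOn_derivWithin (uniqueDiffOn_Ici 0) (by norm_num)
  have hd : ∀ t, 0 < t → HasDerivAt β (β' t) t := fun t ht => by
    have h1 := (hβ.smooth.differentiableOn (by norm_num) t (mem_Ici.2 (le_of_lt ht)))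
    exact h1.hasDerivWithinAt.hasDerivAt (Ici_mem_nhds ht)
  have hd' : ∀ t, 0 < t → DifferentiableAt ℝ β' t := fun t ht =>
    ((hβ.smooth.derivWithin (m := 1) (uniqueDiffOn_Ici 0) (by norm_cast)).differentiableOn
      (by norm_num)).differentiableAt (Ici_mem_nhds ht)
  -- Extending by constants to `t < 0` makes the integrands continuous on the whole line.
  set r : ℝ → ℝ := fun t => inner ℝ w (β (max t 0) - p) with hr
  set σ : ℝ → ℝ := fun t => ‖β' (max t 0)‖ with hσ
  have hmax : Continuous fun t : ℝ => max t 0 := by fun_prop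
  have hrc : Continuous r :=
    continuous_const.inner ((hβc.comp_continuous hmax fun t => le_max_right t 0).sub
      continuous_const)
  have hσc : Continuous σ := (hβ'c.comp_continuous hmax fun t => le_max_right t 0).norm
  have hr0 : ∀ t, 0 < r t := fun t => (hP _ (hβ.mem _ (le_max_right t 0))).2
  have hσ0 : ∀ t, 0 < σ t := fun t => norm_pos_iff.2 (hβ.regular _ (le_max_right t 0))
  have hr_eq : ∀ t, 0 < t → r t = inner ℝ w (β t - p) := fun t ht => by
    simp only [hr, max_eq_left ht.le]
  have hσ_eq : ∀ t, 0 ≤ t → σ t = ‖β' t‖ := fun t ht => by simp only [hσ, max_eq_left ht]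
  have hrd : ∀ t, 0 < t → HasDerivAt r (inner ℝ w (β' t)) t := fun t ht => by
    have h1 : HasDerivAt (fun s => inner ℝ w (β s - p)) (inner ℝ w (β' t)) t := by
      simpa using (hasDerivAt_const t w).inner ℝ ((hd t ht).sub_const p)
    refine h1.congr_of_eventuallyEq ?_
    filter_upwards [Ioi_mem_nhds ht] with s hs using hr_eq s hs
  have hint : ¬ IntegrableOn σ (Ioi 0) := by
    intro hi
    have h1 := hi.hasFiniteIntegral.ne
    refine h1 ?_
    rw [← hβ.infinite_length, setLIntegral_congr Ioi_ae_eq_Ici.symm]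
    refine setLIntegral_congr_fun measurableSet_Ioi fun t ht => ?_
    simp only [hσ_eq t (le_of_lt ht), enorm_norm, hβ']
  have hwnorm : ‖w‖ = 1 := by
    rwa [real_inner_self_eq_norm_sq, pow_eq_one_iff_of_nonneg (norm_nonneg w) two_ne_zero] at hw
  have htop := exists_le_integral_div hσc (fun t => (hσ0 t).le) hrc hr0
    (fun t ht => ⟨_, hrd t ht, by
      rw [hσ_eq t ht.le]
      simpa [hwnorm] using real_inner_le_norm w (β' t)⟩) hint
  have hdiv : Continuous fun a => σ a / r a := hσc.div hrc fun a => (hr0 a).ne'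
  set τ : ℝ → ℝ := fun t => ∫ a in (0 : ℝ)..t, σ a / r a with hτ
  have hτd : ∀ t, HasDerivAt τ (σ t / r t) t :=
    fun t => (hdiv.integral_hasStrictDerivAt 0 t).hasDerivAt
  set q : ℝ → ℝ := fun a => inner ℝ w (β a - p) / ‖β' a‖ with hq
  have hqd : ∀ t, 0 < t → DifferentiableAt ℝ q t := fun t ht => by
    have hne := hβ.regular t ht.le
    have h1 : DifferentiableAt ℝ (fun a => inner ℝ w (β a - p)) t :=
      (differentiableAt_const w).inner ℝ ((hd t ht).differentiableAt.sub_const p)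
    exact h1.div ((hd' t ht).norm ℝ hne) (norm_ne_zero_iff.2 hne)
  have hqinv : ∀ t, 0 < t → q t = (σ t / r t)⁻¹ := fun t ht => by
    rw [inv_div, hr_eq t ht, hσ_eq t ht.le]
  have main : ∀ u₁ u₂ : ℝ × Real.Angle → ℝ, IsBoundedHarmonic (revolution p w n β) u₁ →
      IsBoundedHarmonic (revolution p w n β) u₂ → (∀ ϑ : Real.Angle, u₁ (0, ϑ) = u₂ (0, ϑ)) →
      ∀ x ∈ halfCylinder, u₁ x ≤ u₂ x := by
    intro u₁ u₂ h₁ h₂ hbd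
    have hflux : ∀ u, IsBoundedHarmonic (revolution p w n β) u → ∀ t, 0 < t → ∀ θ,
        fluxLaplacian q (lift u) t θ = 0 := fun u hu t ht θ =>
      fluxLaplacian_eq_zero_of_laplaceBeltrami hw hn hwn hd (fun t ht => hβ.regular t ht.le)
        (fun t ht => (hP _ (hβ.mem t ht.le)).1) (fun t ht => (hP _ (hβ.mem t ht.le)).2) ht
        (hu.laplace_eq_zero t ht θ)
    obtain ⟨C₁, hC₁⟩ := h₁.bounded
    obtain ⟨C₂, hC₂⟩ := h₂.bounded
    have := nonpos_of_fluxLaplacian_eq_zero (q := q) (τ := τ) (u := fun x => u₁ x - u₂ x)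
      (C := C₁ + C₂)
      (fun t ht => by rw [hqinv t ht]; exact inv_pos.2 (div_pos (hσ0 t) (hr0 t))) hqd
      (fun t _ => (hτd t).continuousAt.continuousWithinAt)
      (fun t ht => intervalIntegral.integral_nonneg ht fun a _ => (div_pos (hσ0 a) (hr0 a)).le)
      (fun t ht => by rw [hqinv t ht, inv_inv]; exact hτd t) htop
      (h₁.continuousOn.sub h₂.continuousOn)
      (fun x hx => by linarith [(abs_le.1 (hC₁ x hx)).2, (abs_le.1 (hC₂ x hx)).1])
      (h₁.contDiffOn.sub h₂.contDiffOn)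
      (fun t ht θ => by
        have := fluxLaplacian_sub h₁.contDiffOn h₂.contDiffOn ht (hqd t ht) θ
        rw [hflux u₁ h₁ t ht θ, hflux u₂ h₂ t ht θ, sub_zero] at this
        exact this)
      (fun ϑ => by simp [hbd ϑ])
    exact fun x hx => sub_nonpos.1 (this x hx)
  intro u₁ u₂ h₁ h₂ hbd x hx
  exact le_antisymm (main u₁ u₂ h₁ h₂ hbd x hx) (main u₂ u₁ h₂ h₁ (fun ϑ => (hbd ϑ).symm) x hx)

end Metric

theorem inner_of_mem_euclideanHalfPlane {p v w n : E3} (h : Orthonormal ℝ ![v, w, n]) {x : E3}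
    (hx : x ∈ euclideanHalfPlane p v w) : inner ℝ n (x - p) = 0 ∧ 0 < inner ℝ w (x - p) := by
  obtain ⟨t₁, t₂, ht₂, rfl⟩ := hx
  have hwv : inner ℝ w v = 0 := h.2 (i := 1) (j := 0) (by decide)
  have hnv : inner ℝ n v = 0 := h.2 (i := 2) (j := 0) (by decide)
  have hnw : inner ℝ n w = 0 := h.2 (i := 2) (j := 1) (by decide)
  have hw : ‖w‖ = 1 := h.1 1
  simpa [inner_add_right, real_inner_smul_right, hwv, hnv, hnw, hw] using ht₂

theorem inner_of_mem_sphericalHalfPlane {p v w n : E4} (h : Orthonormal ℝ ![p, v, w, n]) {x : E4}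
    (hx : x ∈ sphericalHalfPlane p v w) : inner ℝ n x = 0 ∧ 0 < inner ℝ w x := by
  obtain ⟨t₁, t₂, ht₂, hlt, rfl⟩ := hx
  have hwp : inner ℝ w p = 0 := h.2 (i := 2) (j := 0) (by decide)
  have hwv : inner ℝ w v = 0 := h.2 (i := 2) (j := 1) (by decide)
  have hnp : inner ℝ n p = 0 := h.2 (i := 3) (j := 0) (by decide)
  have hnv : inner ℝ n v = 0 := h.2 (i := 3) (j := 1) (by decide)
  have hnw : inner ℝ n w = 0 := h.2 (i := 3) (j := 2) (by decide)
  have hw : ‖w‖ = 1 := h.1 2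
  have hsinc : 0 < Real.sinc ‖t₁ • v + t₂ • w‖ := by
    rcases (norm_nonneg (t₁ • v + t₂ • w)).eq_or_lt with h0 | h0
    · rw [← h0, Real.sinc_zero]
      exact one_pos
    · rw [Real.sinc_of_ne_zero h0.ne']
      exact div_pos (Real.sin_pos_of_pos_of_lt_pi h0 hlt) h0
  simpa [sphereExp, inner_add_right, real_inner_smul_right, hwp, hwv, hnp, hnv, hnw, hw]
    using mul_pos hsinc ht₂

end EndOfRevolution

theorem theoremA :
    (∀ p v w n : EndOfRevolution.E3, Orthonormal ℝ ![v, w, n] →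
      ∀ β : ℝ → EndOfRevolution.E3,
        EndOfRevolution.IsCompleteGeneratingCurve (EndOfRevolution.euclideanHalfPlane p v w) β →
          EndOfRevolution.IsParabolic (EndOfRevolution.euclideanEnd p w n β)) ∧
    (∀ p v w n : EndOfRevolution.E4, Orthonormal ℝ ![p, v, w, n] →
      ∀ β : ℝ → EndOfRevolution.E4,
        EndOfRevolution.IsCompleteGeneratingCurve (EndOfRevolution.sphericalHalfPlane p v w) β →
          EndOfRevolution.IsParabolic (EndOfRevolution.sphericalEnd w n β)) := by
  constructor
  · intro p v w n h β hβ
    have hw : ‖w‖ = 1 := h.1 1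
    have hn : ‖n‖ = 1 := h.1 2
    exact EndOfRevolution.isParabolic_revolution (by simp [hw]) (by simp [hn])
      (h.2 (i := 1) (j := 2) (by decide))
      (fun x hx => EndOfRevolution.inner_of_mem_euclideanHalfPlane h hx) hβ
  · intro p v w n h β hβ
    have hw : ‖w‖ = 1 := h.1 2
    have hn : ‖n‖ = 1 := h.1 3
    have hend : EndOfRevolution.sphericalEnd w n β = EndOfRevolution.revolution 0 w n β := by
      funext x
      simp [EndOfRevolution.sphericalEnd, EndOfRevolution.revolution]
    rw [hend]
    exact EndOfRevolution.isParabolic_revolution (by simp [hw]) (by simp [hn])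
      (h.2 (i := 2) (j := 3) (by decide))
      (fun x hx => by
        simpa using EndOfRevolution.inner_of_mem_sphericalHalfPlane h hx) hβ
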